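/- Let $S$ be a discrete semigroup that is left reversible, i.e. $sS\cap tS\neq\emptyset$ for all $s,t\in S$. Let $C$ be a closed convex subset of a complex Hilbert space $H$, and let $\mathcal S=\{T_s : s\in S\}$ be a representation of $S$ on $C$, i.e. each $T_s$ maps $C$ into $C$ and $T_{st}x=T_s(T_tx)$ for all $s,t\in S$, $x\in C$. Suppose that the representation is nonexpansive, i.e. $\|T_sx-T_sy\|\le\|x-y\|$ for all $s\in S$, $x,y\in C$, and affine, i.e. $T_s(ax+by)=aT_sx+bT_sy$ for all $s\in S$, $x,y\in C$ and real $a,b\ge 0$ with $a+b=1$. If $\{T_sc : s\in S\}$ is bounded for some $c\in C$, then $\mathcal S$ has a common fixed point in $C$: there is $x\in C$ with $T_sx=x$ for all $s\in S$. -/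

import Mathlib

/-- A semigroup with a topology is left reversible if the closures of `sS` and `tS` meet
for all `s, t`. (For the discrete topology this says that `sS` and `tS` meet.) -/
def IsLeftReversible (S : Type*) [Semigroup S] [TopologicalSpace S] : Prop :=
  ∀ s t : S, (closure (Set.range fun u : S => s * u) ∩
    closure (Set.range fun u : S => t * u)).Nonempty

/-- `T` is a representation of the semigroup `S` on the set `C`: `T_{st} x = T_s (T_t x)`. -/
def IsRepresentation {S E : Type*} [Semigroup S] {C : Set E} (T : S → C → C) : Prop :=
  ∀ (s t : S) (x : C), T (s * t) x = T s (T t x)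

/-- Every `T_s` is nonexpansive on `C`. -/
def IsNonexpansiveFamily {S E : Type*} [NormedAddCommGroup E] {C : Set E}
    (T : S → C → C) : Prop :=
  ∀ (s : S) (x y : C), ‖(T s x : E) - (T s y : E)‖ ≤ ‖(x : E) - (y : E)‖

/-- `C` is convex and every `T_s` is affine on `C`: `T_s (a x + b y) = a T_s x + b T_s y`
whenever `x, y ∈ C`, `a, b ≥ 0` and `a + b = 1`. The point `z` below is `a x + b y`, seen as an
element of `C`. -/
def IsAffineFamily {S E : Type*} [AddCommGroup E] [Module ℝ E] {C : Set E}
    (T : S → C → C) : Prop :=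
  Convex ℝ C ∧
    ∀ (s : S) (x y z : C) (a b : ℝ), 0 ≤ a → 0 ≤ b → a + b = 1 →
      (z : E) = a • (x : E) + b • (y : E) →
        (T s z : E) = a • (T s x : E) + b • (T s y : E)

/-- The set of common fixed points of the family `T` in `C`. -/
def commonFixedPoints {S E : Type*} {C : Set E} (T : S → C → C) : Set C :=
  {x | ∀ s : S, T s x = x}

/-! Asymptotic centre argument. Minimise over `y` in `C` the radius `r` in `EventuallyNear`. By the
parallelogram law two near-minimisers are close (`EventuallyNear.midpoint`), so a minimising
sequence is Cauchy. Each `T t` keeps the radius (`EventuallyNear.map`), so it moves near-minimisers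
little and fixes their limit. -/

/-- The squared distance to the orbit of `c` is at most `r`, along some right ideal `sS`. -/
def EventuallyNear {S H : Type*} [Semigroup S] [NormedAddCommGroup H] {C : Set H}
    (T : S → C → C) (c y : C) (r : ℝ) : Prop :=
  ∃ s : S, ∀ u : S, ‖(T (s * u) c : H) - (y : H)‖ ^ 2 ≤ r

theorem IsLeftReversible.exists_mul_eq_mul {S : Type*} [Semigroup S] [TopologicalSpace S]
    [DiscreteTopology S] (hS : IsLeftReversible S) (s t : S) : ∃ u v : S, s * u = t * v := by
  obtain ⟨x, hx, hy⟩ := hS s t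
  rw [closure_discrete] at hx hy
  obtain ⟨u, rfl⟩ := hx
  obtain ⟨v, hv⟩ := hy
  exact ⟨u, v, hv.symm⟩

/-- `T t` carries the orbit along `sS` to the orbit along `(t * s)S` without increasing distances.
-/
theorem EventuallyNear.map {S H : Type*} [Semigroup S] [NormedAddCommGroup H] {C : Set H}
    {T : S → C → C} (hT : IsRepresentation T) (hne : IsNonexpansiveFamily T) {c y : C} {r : ℝ}
    (h : EventuallyNear T c y r) (t : S) : EventuallyNear T c (T t y) r := by
  obtain ⟨s, hs⟩ := h
  refine ⟨t * s, fun u => le_trans ?_ (hs u)⟩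
  rw [mul_assoc, hT t (s * u) c]
  have := hne t (T (s * u) c) y
  gcongr

theorem norm_sub_midpoint_sq {H : Type*} [NormedAddCommGroup H] [InnerProductSpace ℂ H]
    (p y z : H) :
    ‖p - ((1 / 2 : ℝ) • y + (1 / 2 : ℝ) • z)‖ ^ 2
      = (‖p - y‖ ^ 2 + ‖p - z‖ ^ 2) / 2 - ‖y - z‖ ^ 2 / 4 := by
  have h := parallelogram_law_with_norm ℂ (p - y) (p - z)
  have h1 : p - ((1 / 2 : ℝ) • y + (1 / 2 : ℝ) • z) = (1 / 2 : ℝ) • ((p - y) + (p - z)) := by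
    module
  have h2 : (p - y) - (p - z) = -(y - z) := by abel
  rw [h2, norm_neg] at h
  rw [h1, norm_smul, Real.norm_of_nonneg (by norm_num)]
  linear_combination h / 4

/-- Left reversibility gives `s * u = t * v`, so both bounds hold along the right ideal `(s * u)S`;
the gain is uniform convexity. -/
theorem EventuallyNear.midpoint {S H : Type*} [Semigroup S] [TopologicalSpace S]
    [DiscreteTopology S] (hS : IsLeftReversible S) [NormedAddCommGroup H] [InnerProductSpace ℂ H]
    {C : Set H} {T : S → C → C} {c y z m : C} {r : ℝ}
    (hy : EventuallyNear T c y r) (hz : EventuallyNear T c z r)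
    (hm : (m : H) = (1 / 2 : ℝ) • (y : H) + (1 / 2 : ℝ) • (z : H)) :
    EventuallyNear T c m (r - ‖(y : H) - z‖ ^ 2 / 4) := by
  obtain ⟨s, hs⟩ := hy
  obtain ⟨t, ht⟩ := hz
  obtain ⟨u, v, huv⟩ := hS.exists_mul_eq_mul s t
  refine ⟨s * u, fun w => ?_⟩
  have h1 := hs (u * w)
  have h2 := ht (v * w)
  rw [← mul_assoc] at h1 h2
  rw [← huv] at h2
  rw [hm, norm_sub_midpoint_sq]
  linarith

theorem mainTheorem5 {S : Type*} [Semigroup S] [TopologicalSpace S] [DiscreteTopology S]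
    (hS : IsLeftReversible S)
    {H : Type*} [NormedAddCommGroup H] [InnerProductSpace ℂ H] [CompleteSpace H]
    {C : Set H} (hC : IsClosed C)
    (T : S → C → C) (hT : IsRepresentation T) (hne : IsNonexpansiveFamily T)
    (haff : IsAffineFamily T)
    (hbdd : ∃ c : C, Bornology.IsBounded (Set.range fun s : S => (T s c : H))) :
    (commonFixedPoints T).Nonempty := by
  obtain ⟨c, hc⟩ := hbdd
  rcases isEmpty_or_nonempty S with hE | ⟨⟨s₀⟩⟩
  · exact ⟨c, fun s => hE.elim s⟩
  let R : Set ℝ := {r | ∃ y : C, EventuallyNear T c y r}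
  have hRne : R.Nonempty := by
    obtain ⟨M, hM⟩ := hc.subset_closedBall (c : H)
    refine ⟨M ^ 2, c, s₀, fun u => ?_⟩
    have h : ‖(T (s₀ * u) c : H) - c‖ ≤ M := mem_closedBall_iff_norm.1 (hM ⟨s₀ * u, rfl⟩)
    gcongr
  have hRbdd : BddBelow R := by
    refine ⟨0, ?_⟩
    rintro r ⟨y, s, hs⟩
    exact (sq_nonneg _).trans (hs s)
  have hclose : ∀ (y z : C) (ε : ℝ), EventuallyNear T c y (sInf R + ε) →
      EventuallyNear T c z (sInf R + ε) → ‖(y : H) - z‖ ^ 2 ≤ 4 * ε := by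
    intro y z ε hy hz
    have hmem : (1 / 2 : ℝ) • (y : H) + (1 / 2 : ℝ) • (z : H) ∈ C :=
      haff.1 y.2 z.2 (by norm_num) (by norm_num) (by norm_num)
    -- The midpoint's radius cannot drop below the infimum.
    have := csInf_le hRbdd ⟨⟨_, hmem⟩, hy.midpoint hS hz rfl⟩
    linarith
  have hex : ∀ n : ℕ, ∃ y : C, EventuallyNear T c y (sInf R + 1 / ((n : ℝ) + 1)) := by
    intro n
    obtain ⟨r, ⟨y, s, hs⟩, hr⟩ :=
      exists_lt_of_csInf_lt hRne (lt_add_of_pos_right (sInf R) (Nat.one_div_pos_of_nat (n := n)))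
    exact ⟨y, s, fun u => (hs u).trans hr.le⟩
  choose y hy using hex
  have hy' : ∀ N n : ℕ, N ≤ n → EventuallyNear T c (y n) (sInf R + 1 / ((N : ℝ) + 1)) := by
    intro N n hn
    obtain ⟨s, hs⟩ := hy n
    exact ⟨s, fun u => (hs u).trans (by gcongr)⟩
  have hlim : Filter.Tendsto (fun n : ℕ => √(4 * (1 / ((n : ℝ) + 1)))) Filter.atTop (nhds 0) := by
    simpa using (tendsto_one_div_add_atTop_nhds_zero_nat (𝕜 := ℝ).const_mul 4).sqrt
  have hcauchy : CauchySeq y := by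
    refine cauchySeq_of_le_tendsto_0 _ (fun n m N hn hm => ?_) hlim
    rw [Subtype.dist_eq, dist_eq_norm]
    exact Real.le_sqrt_of_sq_le (hclose _ _ _ (hy' N n hn) (hy' N m hm))
  have : CompleteSpace C := hC.completeSpace_coe
  obtain ⟨x, hx⟩ := cauchySeq_tendsto_of_complete hcauchy
  refine ⟨x, fun t => ?_⟩
  have hcont : Continuous (T t) :=
    (LipschitzWith.of_dist_le_mul (K := 1) fun a b => by
      simpa [Subtype.dist_eq, dist_eq_norm] using hne t a b).continuous
  have hTx : Filter.Tendsto (fun n => T t (y n)) Filter.atTop (nhds (T t x)) :=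
    (hcont.tendsto x).comp hx
  -- `T t (y n)` and `y n` are near-minimisers at the same level.
  have hdist : Filter.Tendsto (fun n => dist (T t (y n)) (y n)) Filter.atTop (nhds 0) := by
    refine squeeze_zero (fun _ => dist_nonneg) (fun n => ?_) hlim
    rw [Subtype.dist_eq, dist_eq_norm]
    exact Real.le_sqrt_of_sq_le (hclose _ _ _ ((hy n).map hT hne t) (hy n))
  exact dist_eq_zero.1 (tendsto_nhds_unique (hTx.dist hx) hdist)
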